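/- For $\lambda>0$ let $$g_\lambda(x)=\frac{x^{\lambda}\,\Gamma(x)}{\Gamma(\lambda+x)},\qquad x>0.$$ For real $\tau$, let $\mathcal S_\tau$ denote the class of generalized Stieltjes functions of order $\tau$, that is, of the functions $f:(0,\infty)\to\mathbb R$ of the form $$f(x)=\int_{[0,\infty)}\frac{d\mu(t)}{(t+x)^{\tau}}+c,\qquad x>0,$$ where $\mu$ is a positive Borel measure on $[0,\infty)$ for which the integral converges for every $x>0$, and $c\ge 0$ is a constant. Let $\lambda>1$. Then $-\log g_\lambda\in\mathcal S_2$. If moreover $\lambda$ is not an integer, then $-\log g_\lambda\notin\mathcal S_\tau$ for every real $\tau<2$. -/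

import Mathlib

open MeasureTheory Set

/-- The function `g_λ(x) = x ^ λ Γ(x) / Γ(λ + x)`, considered for `x > 0`. -/
noncomputable def gRatio (lam x : ℝ) : ℝ :=
  x ^ lam * Real.Gamma x / Real.Gamma (lam + x)

/-- The class `S_τ` of generalized Stieltjes functions of order `τ`: functions on `(0, ∞)`
(only the values at `x > 0` matter) of the form `f(x) = ∫_{[0,∞)} dμ(t) / (t + x) ^ τ + c`
with a positive Borel measure `μ` on `[0, ∞)` making the integral converge for every `x > 0`,
and a constant `c ≥ 0`. -/
def genStieltjes (τ : ℝ) : Set (ℝ → ℝ) :=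
  {f | ∃ (μ : Measure ℝ) (c : ℝ), 0 ≤ c ∧ ∀ x : ℝ, 0 < x →
    IntegrableOn (fun t : ℝ => 1 / (t + x) ^ τ) (Ici 0) μ ∧
    f x = (∫ t in Ici (0 : ℝ), 1 / (t + x) ^ τ ∂μ) + c}

/-! Write `f = -log g_λ`. The functional equation of Gamma reduces `f(x) - f(x+1)` to logarithms,
and this equals the order-2 transform of a tent-shaped density on `(0, λ]`. Since `f(x+n) → 0`,
telescoping represents `f` by `ν`, the sum of the natural-number translates of the tent measure
(`lintegral_tentSeriesMeasure`).

For sharpness with `0 < τ < 2`, suppose `f` is also the order-`τ` transform of `μ`. The Gamma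
integral turns both transforms into Laplace transforms of densities; uniqueness and analytic
continuation give `z^(τ-1) Lμ(z)/Γ(τ) = z Lν(z)` for `Re z > 0` (`laplace_eqOn_of_stieltjes_eq`).
From `|Lμ(z)| ≤ Lμ(Re z)` follows `|Lν(z)| ≤ (Re z/|z|)^(2-τ) Lν(Re z)`. Here `Lν(z) = W(z)/(1 -
e^(-z))`, with `W` the Laplace transform of the tent. Taking `z = a + 2πi`, the periodic
denominators cancel, and `a → 0` forces `W(2πi) = 0`. But `W(2πi)` is a nonzero multiple of
`e^(-2πiλ) - 1`, so `λ` is an integer. For `τ ≤ 0` monotonicity alone excludes `f`. -/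

open Filter Topology ProbabilityTheory

/-! ### Uniqueness of Laplace transforms -/

/-- Two functions that are analytic on the right half plane and agree at almost every positive
real number agree on the whole right half plane. -/
lemma eqOn_re_pos_of_ae_eq {F G : ℂ → ℂ} (hF : AnalyticOnNhd ℂ F {z | 0 < z.re})
    (hG : AnalyticOnNhd ℂ G {z | 0 < z.re})
    (h : ∀ᵐ x : ℝ ∂volume.restrict (Ioi 0), F x = G x) : EqOn F G {z | 0 < z.re} := by
  have hmaps : MapsTo (fun x : ℝ => (x : ℂ)) (Ioi 0) {z : ℂ | 0 < z.re} := fun x hx => by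
    simpa using hx
  have hreal : EqOn (fun x : ℝ => F x) (fun x : ℝ => G x) (Ioi 0) :=
    Measure.eqOn_open_of_ae_eq (μ := volume) h isOpen_Ioi
      (hF.continuousOn.comp Complex.continuous_ofReal.continuousOn hmaps)
      (hG.continuousOn.comp Complex.continuous_ofReal.continuousOn hmaps)
  refine AnalyticOnNhd.eqOn_of_preconnected_of_frequently_eq hF hG
    (convex_halfSpace_re_gt 0).isPreconnected (z₀ := ((1 : ℝ) : ℂ))
    (by simp) ?_
  have hev : ∀ᶠ x : ℝ in 𝓝[≠] 1, F x = G x :=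
    eventually_nhdsWithin_of_eventually_nhds
      ((isOpen_Ioi.eventually_mem (zero_lt_one (α := ℝ))).mono hreal)
  have htend : Tendsto (fun x : ℝ => (x : ℂ)) (𝓝[≠] 1) (𝓝[≠] ((1 : ℝ) : ℂ)) :=
    tendsto_nhdsWithin_iff.2
      ⟨Complex.continuous_ofReal.continuousAt.tendsto.mono_left nhdsWithin_le_nhds,
        eventually_nhdsWithin_of_forall fun x hx => by simpa using hx⟩
  exact htend.frequently hev.frequently

lemma analyticOnNhd_complexMGF_neg {ρ : Measure ℝ}
    (h : ∀ x : ℝ, 0 < x → Integrable (fun t => Real.exp (-(x * t))) ρ) :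
    AnalyticOnNhd ℂ (complexMGF (fun t => -t) ρ) {z | 0 < z.re} := by
  refine analyticOnNhd_complexMGF.mono fun z hz => ?_
  exact interior_maximal (t := Ioi 0)
    (fun x hx => by simpa [integrableExpSet] using h x hx) isOpen_Ioi hz

/-- The Laplace transform determines a density on `(0, ∞)`. -/
lemma ae_eq_of_lintegral_exp_neg_mul_eq {p q : ℝ → ENNReal} (hp : Measurable p) (hq : Measurable q)
    (hfin : ∀ x : ℝ, 0 < x → ∫⁻ s in Ioi 0, ENNReal.ofReal (Real.exp (-(x * s))) * p s ≠ ⊤)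
    (heq : ∀ x : ℝ, 0 < x → ∫⁻ s in Ioi 0, ENNReal.ofReal (Real.exp (-(x * s))) * p s =
      ∫⁻ s in Ioi 0, ENNReal.ofReal (Real.exp (-(x * s))) * q s) :
    p =ᵐ[volume.restrict (Ioi 0)] q := by
  set v : Measure ℝ := volume.restrict (Ioi 0) with hv
  have hfin' : ∀ x : ℝ, 0 < x → ∫⁻ s, ENNReal.ofReal (Real.exp (-(x * s))) * q s ∂v ≠ ⊤ :=
    fun x hx => heq x hx ▸ hfin x hx
  have hlin : ∀ {r : ℝ → ENNReal}, Measurable r → ∀ x : ℝ,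
      ∫⁻ s, ENNReal.ofReal (Real.exp (-(x * s))) ∂(v.withDensity r) =
        ∫⁻ s, ENNReal.ofReal (Real.exp (-(x * s))) * r s ∂v := fun {r} hr x => by
    rw [lintegral_withDensity_eq_lintegral_mul _ hr (by fun_prop)]
    simp [mul_comm]
  have hint : ∀ {r : ℝ → ENNReal}, Measurable r →
      (∀ x : ℝ, 0 < x → ∫⁻ s, ENNReal.ofReal (Real.exp (-(x * s))) * r s ∂v ≠ ⊤) →
      ∀ x : ℝ, 0 < x → Integrable (fun t => Real.exp (-(x * t))) (v.withDensity r) :=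
    fun {r} hr h x hx => by
      rw [← lintegral_ofReal_ne_top_iff_integrable (by fun_prop) (ae_of_all _ fun _ => by positivity),
        hlin hr]
      exact h x hx
  have hmgf : ∀ x : ℝ, 0 < x → complexMGF (fun t => -t) (v.withDensity p) x =
      complexMGF (fun t => -t) (v.withDensity q) x := fun x hx => by
    rw [complexMGF_ofReal, complexMGF_ofReal]
    simp only [mgf, mul_neg]
    rw [integral_eq_lintegral_of_nonneg_ae (ae_of_all _ fun _ => by positivity) (by fun_prop),
      integral_eq_lintegral_of_nonneg_ae (ae_of_all _ fun _ => by positivity) (by fun_prop),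
      hlin hp, hlin hq, heq x hx]
  have hEq := eqOn_re_pos_of_ae_eq (analyticOnNhd_complexMGF_neg (hint hp hfin))
    (analyticOnNhd_complexMGF_neg (hint hq hfin'))
    ((ae_restrict_mem measurableSet_Ioi).mono fun x hx => hmgf x hx)
  -- Tilting by `exp (-s)` makes both measures finite; their characteristic functions are then the
  -- Laplace transforms on the line `Re z = 1`.
  have hexp : Measurable fun s : ℝ => ENNReal.ofReal (Real.exp (-(1 * s))) := by fun_prop
  have hfinite : ∀ {r : ℝ → ENNReal}, Measurable r →
      ∫⁻ s, ENNReal.ofReal (Real.exp (-(1 * s))) * r s ∂v ≠ ⊤ →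
      IsFiniteMeasure ((v.withDensity r).withDensity
        fun s => ENNReal.ofReal (Real.exp (-(1 * s)))) := fun {r} hr h =>
    isFiniteMeasure_withDensity (by rwa [hlin hr])
  have := hfinite hp (hfin 1 one_pos)
  have := hfinite hq (hfin' 1 one_pos)
  have hchar : ∀ (r : ℝ → ENNReal) (y : ℝ),
      charFun ((v.withDensity r).withDensity fun s => ENNReal.ofReal (Real.exp (-(1 * s)))) y =
        complexMGF (fun t => -t) (v.withDensity r) (1 - y * Complex.I) := fun r y => by
    rw [charFun_apply_real, complexMGF, integral_withDensity_eq_integral_toReal_smul hexp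
      (ae_of_all _ fun _ => ENNReal.ofReal_lt_top)]
    congr with s
    rw [ENNReal.toReal_ofReal (by positivity), Complex.real_smul, Complex.ofReal_exp,
      ← Complex.exp_add]
    congr 1
    push_cast
    ring
  have hmeas : (v.withDensity p).withDensity (fun s => ENNReal.ofReal (Real.exp (-(1 * s)))) =
      (v.withDensity q).withDensity fun s => ENNReal.ofReal (Real.exp (-(1 * s))) := by
    refine Measure.ext_of_charFun (funext fun y => ?_)
    rw [hchar, hchar]
    exact hEq (by simp)
  rw [← withDensity_mul _ hp hexp, ← withDensity_mul _ hq hexp, withDensity_eq_iff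
    (by fun_prop) (by fun_prop) (by simpa [mul_comm] using hfin 1 one_pos)] at hmeas
  filter_upwards [hmeas] with s hs
  simp only [Pi.mul_apply] at hs
  exact (ENNReal.mul_left_inj (by simp; positivity) ENNReal.ofReal_ne_top).1 hs

/-! ### Stieltjes transforms as Laplace transforms -/

/-- The weight is a.e. positive and makes `ρ` finite; dividing it out again leaves an s-finite
measure, as Tonelli requires. -/
lemma sFinite_of_integrable_one_div_add_rpow {ρ : Measure ℝ} {κ : ℝ} (h0 : ∀ᵐ t ∂ρ, 0 ≤ t)
    (h : Integrable (fun t : ℝ => 1 / (t + 1) ^ κ) ρ) : SFinite ρ := by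
  have hm : Measurable fun t : ℝ => ENNReal.ofReal (1 / (t + 1) ^ κ) := by fun_prop
  have hfin : IsFiniteMeasure (ρ.withDensity fun t => ENNReal.ofReal (1 / (t + 1) ^ κ)) :=
    isFiniteMeasure_withDensity_ofReal h.2
  rw [← withDensity_inv_same hm
    (h0.mono fun t ht => by simp only [ne_eq, ENNReal.ofReal_eq_zero, not_le]; positivity)
    (ae_of_all _ fun t => ENNReal.ofReal_ne_top)]
  infer_instance

lemma integrable_exp_neg_mul_of_integrable_one_div_add_rpow {ρ : Measure ℝ} {κ : ℝ} (hκ : 0 < κ)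
    (h0 : ∀ᵐ t ∂ρ, 0 ≤ t) (h : Integrable (fun t : ℝ => 1 / (t + 1) ^ κ) ρ) {s : ℝ} (hs : 0 < s) :
    Integrable (fun t => Real.exp (-(s * t))) ρ := by
  refine (h.const_mul ((κ / s) ^ κ * Real.exp s)).mono' (by fun_prop) (h0.mono fun t ht => ?_)
  rw [Real.norm_of_nonneg (by positivity), mul_one_div, le_div_iff₀ (by positivity)]
  -- This is `u ≤ exp u` at `u = s (t + 1) / κ`; its `κ`-th power bounds `(t + 1) ^ κ` by a multiple
  -- of `exp (s (t + 1))`.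
  have h1 : t + 1 ≤ κ / s * Real.exp (s * (t + 1) / κ) := by
    have := Real.add_one_le_exp (s * (t + 1) / κ)
    calc t + 1 = κ / s * (s * (t + 1) / κ) := by field_simp
      _ ≤ _ := by gcongr; linarith
  have h2 : (t + 1) ^ κ ≤ (κ / s) ^ κ * Real.exp (s * (t + 1)) := by
    refine (Real.rpow_le_rpow (by positivity) h1 hκ.le).trans_eq ?_
    rw [Real.mul_rpow (by positivity) (by positivity), ← Real.exp_mul]
    congr 2
    field_simp
  calc Real.exp (-(s * t)) * (t + 1) ^ κ
      ≤ Real.exp (-(s * t)) * ((κ / s) ^ κ * Real.exp (s * (t + 1))) := by gcongr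
    _ = (κ / s) ^ κ * (Real.exp (-(s * t)) * Real.exp (s * (t + 1))) := by ring
    _ = _ := by rw [← Real.exp_add]; ring_nf

/-- Write the kernel as a Gamma integral in `s` and swap the integrals by Tonelli. -/
lemma lintegral_one_div_add_rpow_eq_laplace {ρ : Measure ℝ} [SFinite ρ] (h0 : ∀ᵐ t ∂ρ, 0 ≤ t)
    {κ x : ℝ} (hκ : 0 < κ) (hx : 0 < x) :
    ∫⁻ t, ENNReal.ofReal (1 / (t + x) ^ κ) ∂ρ =
      ∫⁻ s in Ioi 0, ENNReal.ofReal (Real.exp (-(x * s))) *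
        (ENNReal.ofReal (s ^ (κ - 1) / Real.Gamma κ) *
          ∫⁻ t, ENNReal.ofReal (Real.exp (-(s * t))) ∂ρ) := by
  have hΓ := Real.Gamma_pos_of_pos hκ
  have hker : ∀ t : ℝ, 0 ≤ t → ENNReal.ofReal (1 / (t + x) ^ κ) =
      ∫⁻ s in Ioi 0, ENNReal.ofReal (s ^ (κ - 1) * Real.exp (-((t + x) * s)) / Real.Gamma κ) := by
    intro t ht
    have hpos : 0 < t + x := by positivity
    have hI := Real.integral_rpow_mul_exp_neg_mul_Ioi hκ hpos
    have hint : Integrable (fun s : ℝ => s ^ (κ - 1) * Real.exp (-((t + x) * s)))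
        (volume.restrict (Ioi 0)) := by
      -- A non-integrable function would have integral `0`, but the Gamma integral is positive.
      by_contra hn
      rw [integral_undef hn] at hI
      have : 0 < (1 / (t + x)) ^ κ * Real.Gamma κ := by positivity
      exact this.ne hI
    rw [← ofReal_integral_eq_lintegral_ofReal (hint.div_const _)
      ((ae_restrict_mem measurableSet_Ioi).mono fun s (hs : 0 < s) => by positivity),
      integral_div, hI, Real.div_rpow zero_le_one hpos.le, Real.one_rpow]
    congr 1
    field_simp
  rw [lintegral_congr_ae (h0.mono hker), lintegral_lintegral_swap (by fun_prop)]
  refine setLIntegral_congr_fun measurableSet_Ioi fun s (hs : 0 < s) => ?_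
  rw [← lintegral_const_mul _ (by fun_prop), ← lintegral_const_mul _ (by fun_prop)]
  refine lintegral_congr fun t => ?_
  rw [← ENNReal.ofReal_mul (by positivity), ← ENNReal.ofReal_mul (by positivity)]
  congr 1
  rw [show -((t + x) * s) = -(x * s) + -(s * t) by ring, Real.exp_add]
  ring

lemma measurable_laplace_density (ρ : Measure ℝ) [SFinite ρ] (κ : ℝ) :
    Measurable fun s : ℝ => ENNReal.ofReal (s ^ (κ - 1) / Real.Gamma κ) *
      ∫⁻ t, ENNReal.ofReal (Real.exp (-(s * t))) ∂ρ := by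
  refine Measurable.mul (by fun_prop) (Measurable.lintegral_prod_right ?_)
  fun_prop

/-- If a generalized Stieltjes transform of order `τ` of `μ` equals one of order `κ` of `ν`, then
their Laplace transforms are related by `z ^ (τ - 1) L μ / Γ(τ) = z ^ (κ - 1) L ν / Γ(κ)`. -/
lemma laplace_eqOn_of_stieltjes_eq {μ ν : Measure ℝ} {τ κ : ℝ} (hτ : 0 < τ) (hκ : 0 < κ)
    (hμ0 : ∀ᵐ t ∂μ, 0 ≤ t) (hν0 : ∀ᵐ t ∂ν, 0 ≤ t)
    (hμ : ∀ x : ℝ, 0 < x → Integrable (fun t : ℝ => 1 / (t + x) ^ τ) μ)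
    (hν : ∀ x : ℝ, 0 < x → Integrable (fun t : ℝ => 1 / (t + x) ^ κ) ν)
    (heq : ∀ x : ℝ, 0 < x → ∫ t, 1 / (t + x) ^ τ ∂μ = ∫ t, 1 / (t + x) ^ κ ∂ν) :
    EqOn (fun z : ℂ => z ^ ((τ - 1 : ℝ) : ℂ) / (Real.Gamma τ : ℂ) * complexMGF (fun t => -t) μ z)
      (fun z : ℂ => z ^ ((κ - 1 : ℝ) : ℂ) / (Real.Gamma κ : ℂ) * complexMGF (fun t => -t) ν z)
      {z | 0 < z.re} := by
  have := sFinite_of_integrable_one_div_add_rpow hμ0 (hμ 1 one_pos)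
  have := sFinite_of_integrable_one_div_add_rpow hν0 (hν 1 one_pos)
  have hlint : ∀ {ρ : Measure ℝ} {σ : ℝ}, (∀ᵐ t ∂ρ, 0 ≤ t) →
      (∀ x : ℝ, 0 < x → Integrable (fun t : ℝ => 1 / (t + x) ^ σ) ρ) → ∀ x : ℝ, 0 < x →
      ∫⁻ t, ENNReal.ofReal (1 / (t + x) ^ σ) ∂ρ =
        ENNReal.ofReal (∫ t, 1 / (t + x) ^ σ ∂ρ) := fun h0 h x hx =>
    (ofReal_integral_eq_lintegral_ofReal (h x hx) (h0.mono fun t ht => by positivity)).symm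
  have hμe : ∀ s : ℝ, 0 < s → Integrable (fun t => Real.exp (-(s * t))) μ := fun s hs =>
    integrable_exp_neg_mul_of_integrable_one_div_add_rpow hτ hμ0 (hμ 1 one_pos) hs
  have hνe : ∀ s : ℝ, 0 < s → Integrable (fun t => Real.exp (-(s * t))) ν := fun s hs =>
    integrable_exp_neg_mul_of_integrable_one_div_add_rpow hκ hν0 (hν 1 one_pos) hs
  have hae := ae_eq_of_lintegral_exp_neg_mul_eq (measurable_laplace_density μ τ)
    (measurable_laplace_density ν κ)
    (fun x hx => by
      rw [← lintegral_one_div_add_rpow_eq_laplace hμ0 hτ hx, hlint hμ0 hμ x hx]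
      exact ENNReal.ofReal_ne_top)
    (fun x hx => by
      rw [← lintegral_one_div_add_rpow_eq_laplace hμ0 hτ hx,
        ← lintegral_one_div_add_rpow_eq_laplace hν0 hκ hx, hlint hμ0 hμ x hx,
        hlint hν0 hν x hx, heq x hx])
  have hanal : ∀ {ρ : Measure ℝ} (σ : ℝ),
      (∀ s : ℝ, 0 < s → Integrable (fun t => Real.exp (-(s * t))) ρ) →
      AnalyticOnNhd ℂ (fun z : ℂ => z ^ ((σ - 1 : ℝ) : ℂ) / (Real.Gamma σ : ℂ) *
        complexMGF (fun t => -t) ρ z) {z | 0 < z.re} := fun σ h z hz =>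
    ((analyticAt_id.cpow analyticAt_const (Or.inl hz)).div_const).mul
      (analyticOnNhd_complexMGF_neg h z hz)
  have hval : ∀ {ρ : Measure ℝ} {σ : ℝ}, 0 < σ →
      ∀ {s : ℝ}, 0 < s → Integrable (fun t => Real.exp (-(s * t))) ρ →
      (s : ℂ) ^ ((σ - 1 : ℝ) : ℂ) / (Real.Gamma σ : ℂ) * complexMGF (fun t => -t) ρ s =
        ((ENNReal.ofReal (s ^ (σ - 1) / Real.Gamma σ) *
          ∫⁻ t, ENNReal.ofReal (Real.exp (-(s * t))) ∂ρ).toReal : ℝ) := by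
    intro ρ σ hσ s hs h
    have hΓ := Real.Gamma_pos_of_pos hσ
    rw [ENNReal.toReal_mul, ENNReal.toReal_ofReal (by positivity), complexMGF_ofReal, mgf,
      ← integral_eq_lintegral_of_nonneg_ae (ae_of_all _ fun _ => by positivity) (by fun_prop),
      Complex.ofReal_mul, Complex.ofReal_div, Complex.ofReal_cpow hs.le]
    simp only [mul_neg]
  refine eqOn_re_pos_of_ae_eq (hanal τ hμe) (hanal κ hνe) ?_
  filter_upwards [hae, ae_restrict_mem measurableSet_Ioi] with s hs hs0
  rw [hval hτ hs0 (hμe s hs0), hval hκ hs0 (hνe s hs0), hs]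

/-- If a generalized Stieltjes transform of order `κ` of `ν` is also one of order `τ`, then the
Laplace transform of `ν` decays off the real axis. -/
lemma norm_laplace_le_of_stieltjes_eq {μ ν : Measure ℝ} {τ κ : ℝ} (hτ : 0 < τ) (hκ : 0 < κ)
    (hμ0 : ∀ᵐ t ∂μ, 0 ≤ t) (hν0 : ∀ᵐ t ∂ν, 0 ≤ t)
    (hμ : ∀ x : ℝ, 0 < x → Integrable (fun t : ℝ => 1 / (t + x) ^ τ) μ)
    (hν : ∀ x : ℝ, 0 < x → Integrable (fun t : ℝ => 1 / (t + x) ^ κ) ν)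
    (heq : ∀ x : ℝ, 0 < x → ∫ t, 1 / (t + x) ^ τ ∂μ = ∫ t, 1 / (t + x) ^ κ ∂ν)
    {z : ℂ} (hz : 0 < z.re) :
    ‖complexMGF (fun t => -t) ν z‖ ≤
      (z.re / ‖z‖) ^ (κ - τ) * ‖complexMGF (fun t => -t) ν z.re‖ := by
  have key := laplace_eqOn_of_stieltjes_eq hτ hκ hμ0 hν0 hμ hν heq
  have hzn : 0 < ‖z‖ := hz.trans_le ((le_abs_self _).trans (Complex.abs_re_le_norm z))
  have hΓτ := Real.Gamma_pos_of_pos hτ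
  have hΓκ := Real.Gamma_pos_of_pos hκ
  have hnorm : ∀ w : ℂ, 0 < w.re → ‖complexMGF (fun t => -t) ν w‖ =
      ‖w‖ ^ (τ - κ) * (Real.Gamma κ / Real.Gamma τ) * ‖complexMGF (fun t => -t) μ w‖ := by
    intro w hw
    have hwn : 0 < ‖w‖ := hw.trans_le ((le_abs_self _).trans (Complex.abs_re_le_norm w))
    have h := congrArg norm (key hw)
    simp only [norm_mul, norm_div, Complex.norm_cpow_real, Complex.norm_real, Real.norm_eq_abs,
      abs_of_pos hΓτ, abs_of_pos hΓκ] at h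
    rw [show τ - κ = (τ - 1) - (κ - 1) by ring, Real.rpow_sub hwn]
    have h1 : 0 < ‖w‖ ^ (κ - 1) := by positivity
    field_simp at h ⊢
    linarith
  have hre : 0 < ((z.re : ℝ) : ℂ).re := by simpa using hz
  -- Positivity of `μ` enters here: its Laplace transform is largest on the real axis.
  have hle : ‖complexMGF (fun t => -t) μ z‖ ≤ ‖complexMGF (fun t => -t) μ z.re‖ := by
    refine norm_complexMGF_le_mgf.trans ?_
    rw [complexMGF_ofReal, Complex.norm_real]
    exact le_abs_self _
  rw [hnorm z hz, hnorm _ hre, Complex.norm_real, Real.norm_of_nonneg hz.le,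
    Real.div_rpow hz.le hzn.le, show κ - τ = -(τ - κ) by ring, Real.rpow_neg hz.le,
    Real.rpow_neg hzn.le]
  have h1 : 0 < z.re ^ (τ - κ) := by positivity
  have h2 : 0 < ‖z‖ ^ (τ - κ) := by positivity
  calc _ ≤ ‖z‖ ^ (τ - κ) * (Real.Gamma κ / Real.Gamma τ) * ‖complexMGF (fun t => -t) μ z.re‖ := by
        gcongr
    _ = _ := by field_simp

/-! ### Differences and decay of `-log g_λ` -/

lemma neg_log_gRatio {lam x : ℝ} (hlam : 0 < lam) (hx : 0 < x) :
    -Real.log (gRatio lam x) =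
      Real.log (Real.Gamma (lam + x)) - Real.log (Real.Gamma x) - lam * Real.log x := by
  have h1 := Real.Gamma_pos_of_pos hx
  have h2 := Real.Gamma_pos_of_pos (add_pos hlam hx)
  have h3 : 0 < x ^ lam := by positivity
  rw [gRatio, Real.log_div (by positivity) h2.ne', Real.log_mul h3.ne' h1.ne', Real.log_rpow hx]
  ring

lemma neg_log_gRatio_sub {lam x : ℝ} (hlam : 0 < lam) (hx : 0 < x) :
    -Real.log (gRatio lam x) - -Real.log (gRatio lam (x + 1)) =
      lam * (Real.log (x + 1) - Real.log x) - (Real.log (x + lam) - Real.log x) := by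
  have h2 := add_pos hlam hx
  rw [neg_log_gRatio hlam hx, neg_log_gRatio hlam (by positivity), ← add_assoc,
    Real.Gamma_add_one hx.ne', Real.Gamma_add_one h2.ne',
    Real.log_mul hx.ne' (Real.Gamma_pos_of_pos hx).ne',
    Real.log_mul h2.ne' (Real.Gamma_pos_of_pos h2).ne', add_comm lam x]
  ring

lemma log_Gamma_add_nat_add_one {x : ℝ} (hx : 0 < x) (n : ℕ) :
    Real.log (Real.Gamma (x + (n + 1 : ℕ))) = Real.log (Real.Gamma x) + x * Real.log n +
      Real.log n.factorial - Real.BohrMollerup.logGammaSeq x n := by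
  have hfeq : ∀ {y : ℝ}, 0 < y →
      (Real.log ∘ Real.Gamma) (y + 1) = (Real.log ∘ Real.Gamma) y + Real.log y := fun {y} hy => by
    simp only [Function.comp_apply]
    rw [Real.Gamma_add_one hy.ne', Real.log_mul hy.ne' (Real.Gamma_pos_of_pos hy).ne', add_comm]
  have := Real.BohrMollerup.f_add_nat_eq hfeq hx (n + 1)
  simp only [Function.comp_apply] at this
  rw [this, Real.BohrMollerup.logGammaSeq]
  ring

lemma tendsto_neg_log_gRatio_add_nat {lam x : ℝ} (hlam : 0 < lam) (hx : 0 < x) :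
    Tendsto (fun n : ℕ => -Real.log (gRatio lam (x + n))) atTop (𝓝 0) := by
  -- `logGammaSeq x n` involves `Γ(x + n + 1)`, hence the shift by one.
  rw [← tendsto_add_atTop_iff_nat 1]
  have h1 := (tendsto_const_nhds (x := Real.log (Real.Gamma (lam + x)))).sub
    (Real.BohrMollerup.tendsto_log_gamma (add_pos hlam hx))
  have h2 := (tendsto_const_nhds (x := Real.log (Real.Gamma x))).sub
    (Real.BohrMollerup.tendsto_log_gamma hx)
  have h3 := ((Real.tendsto_log_comp_add_sub_log (x + 1)).comp
    (tendsto_natCast_atTop_atTop (R := ℝ))).const_mul lam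
  have h := (h1.sub h2).sub h3
  simp only [sub_self, mul_zero] at h
  refine h.congr fun n => ?_
  rw [neg_log_gRatio hlam (by positivity), ← add_assoc, log_Gamma_add_nat_add_one hx,
    log_Gamma_add_nat_add_one (add_pos hlam hx)]
  simp only [Function.comp_apply]
  push_cast
  rw [show (n : ℝ) + (x + 1) = x + (n + 1) by ring]
  ring

/-- Strict Bernoulli inequality: `1 + λ/x < (1 + 1/x) ^ λ`. -/
lemma neg_log_gRatio_add_one_lt {lam x : ℝ} (hlam : 1 < lam) (hx : 0 < x) :
    -Real.log (gRatio lam (x + 1)) < -Real.log (gRatio lam x) := by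
  have h0 : 0 < lam := by linarith
  rw [← sub_pos, neg_log_gRatio_sub h0 hx, sub_pos, ← Real.log_div (by positivity) hx.ne',
    ← Real.log_div (by positivity) hx.ne', ← Real.log_rpow (by positivity)]
  refine Real.log_lt_log (by positivity) ?_
  have := one_add_mul_self_lt_rpow_one_add (s := 1 / x) (by
    have : 0 < 1 / x := by positivity
    linarith) (by positivity) hlam
  convert this using 1
  · field_simp
  · congr 1; field_simp

/-! ### The tent density and its transforms -/

/-- The tent function on `[0, λ]` with peak at `1`. -/
noncomputable def tent (lam t : ℝ) : ℝ := min ((lam - 1) * t) (lam - t)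

@[fun_prop]
lemma continuous_tent (lam : ℝ) : Continuous (tent lam) := by
  unfold tent
  fun_prop

lemma tent_nonneg {lam t : ℝ} (hlam : 1 < lam) (ht : t ∈ Ioc 0 lam) : 0 ≤ tent lam t :=
  le_min (mul_nonneg (by linarith) ht.1.le) (by linarith [ht.2])

lemma tent_eq_of_le_one {lam t : ℝ} (hlam : 1 < lam) (ht : t ≤ 1) :
    tent lam t = (lam - 1) * t := min_eq_left (by nlinarith)

lemma tent_eq_of_one_le {lam t : ℝ} (hlam : 1 < lam) (ht : 1 ≤ t) :
    tent lam t = lam - t := min_eq_right (by nlinarith)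

/-- The right side is the integral of `(λ·1_[0,1] - 1_[0,λ])(t) / (t + x)`. The tent is the
primitive of that step function vanishing at `0` and `λ`, so integration by parts explains the
formula. The proof uses explicit antiderivatives on each side of the kink. -/
lemma integral_tent_div_sq {lam x : ℝ} (hlam : 1 < lam) (hx : 0 < x) :
    ∫ t in (0 : ℝ)..lam, tent lam t * (1 / (t + x) ^ (2 : ℝ)) =
      lam * (Real.log (x + 1) - Real.log x) - (Real.log (x + lam) - Real.log x) := by
  have hcont : ∀ a b : ℝ, 0 ≤ a → a ≤ b →
      IntervalIntegrable (fun t => tent lam t * (1 / (t + x) ^ (2 : ℝ))) volume a b :=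
    fun a b ha hab => by
      refine ContinuousOn.intervalIntegrable fun t ht => ?_
      rw [uIcc_of_le hab] at ht
      have : t + x ≠ 0 := by linarith [ht.1]
      have : (t + x) ^ (2 : ℝ) ≠ 0 := by
        have : 0 < t + x := by linarith [ht.1]
        positivity
      fun_prop (disch := first | assumption | exact Or.inl ‹_›)
  rw [← intervalIntegral.integral_add_adjacent_intervals (hcont 0 1 le_rfl zero_le_one)
    (hcont 1 lam zero_le_one hlam.le)]
  have h1 : ∫ t in (0 : ℝ)..1, tent lam t * (1 / (t + x) ^ (2 : ℝ)) =
      (lam - 1) * (Real.log (1 + x) + x / (1 + x)) - (lam - 1) * (Real.log (0 + x) + x / (0 + x)) := by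
    refine intervalIntegral.integral_eq_sub_of_hasDerivAt
      (f := fun t => (lam - 1) * (Real.log (t + x) + x / (t + x))) (fun t ht => ?_)
      (hcont 0 1 le_rfl zero_le_one)
    rw [uIcc_of_le zero_le_one] at ht
    have hpos : t + x ≠ 0 := by linarith [ht.1]
    have hid : HasDerivAt (fun t => t + x) 1 t := (hasDerivAt_id t).add_const x
    have := ((hid.log hpos).add ((hasDerivAt_const t x).div hid hpos)).const_mul (lam - 1)
    refine this.congr_deriv ?_
    rw [tent_eq_of_le_one hlam ht.2, Real.rpow_two]
    field_simp
    ring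
  have h2 : ∫ t in (1 : ℝ)..lam, tent lam t * (1 / (t + x) ^ (2 : ℝ)) =
      (-Real.log (lam + x) - (lam + x) / (lam + x)) - (-Real.log (1 + x) - (lam + x) / (1 + x)) := by
    refine intervalIntegral.integral_eq_sub_of_hasDerivAt
      (f := fun t => -Real.log (t + x) - (lam + x) / (t + x)) (fun t ht => ?_)
      (hcont 1 lam zero_le_one hlam.le)
    rw [uIcc_of_le hlam.le] at ht
    have hpos : t + x ≠ 0 := by linarith [ht.1]
    have hid : HasDerivAt (fun t => t + x) 1 t := (hasDerivAt_id t).add_const x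
    have := (hid.log hpos).neg.sub ((hasDerivAt_const t (lam + x)).div hid hpos)
    refine this.congr_deriv ?_
    rw [tent_eq_of_one_le hlam ht.1, Real.rpow_two]
    field_simp
    ring
  rw [h1, h2, zero_add, add_comm 1 x, add_comm lam x]
  have h3 : x + 1 ≠ 0 := by positivity
  have h4 : x + lam ≠ 0 := by positivity
  field_simp
  ring

lemma integral_tent_mul_cexp {lam : ℝ} (hlam : 1 < lam) {z : ℂ} (hz : z ≠ 0) :
    ∫ t in (0 : ℝ)..lam, (tent lam t : ℂ) * Complex.exp (-(z * t)) =
      (lam * (1 - Complex.exp (-z)) - (1 - Complex.exp (-(z * lam)))) / z ^ 2 := by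
  have hcont : ∀ a b : ℝ,
      IntervalIntegrable (fun t : ℝ => (tent lam t : ℂ) * Complex.exp (-(z * t))) volume a b :=
    fun a b => Continuous.intervalIntegrable (by fun_prop) a b
  have hexp : ∀ t : ℝ, HasDerivAt (fun t : ℝ => Complex.exp (-(z * t)))
      (Complex.exp (-(z * t)) * (-(z * 1))) t := fun t =>
    ((Complex.ofRealCLM.hasDerivAt.const_mul z).neg).cexp
  have hid : ∀ t : ℝ, HasDerivAt (fun t : ℝ => (t : ℂ)) 1 t := fun t =>
    Complex.ofRealCLM.hasDerivAt
  rw [← intervalIntegral.integral_add_adjacent_intervals (hcont 0 1) (hcont 1 lam)]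
  have h1 : ∫ t in (0 : ℝ)..1, (tent lam t : ℂ) * Complex.exp (-(z * t)) =
      (-(lam - 1) * ((1 : ℝ) * z + 1) * Complex.exp (-(z * (1 : ℝ))) / z ^ 2) -
        (-(lam - 1) * ((0 : ℝ) * z + 1) * Complex.exp (-(z * (0 : ℝ))) / z ^ 2) := by
    refine intervalIntegral.integral_eq_sub_of_hasDerivAt
      (f := fun t : ℝ => -(lam - 1) * ((t : ℂ) * z + 1) * Complex.exp (-(z * t)) / z ^ 2)
      (fun t ht => ?_) (hcont 0 1)
    rw [uIcc_of_le zero_le_one] at ht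
    have := (((((hid t).mul_const z).add_const 1).const_mul (-((lam : ℂ) - 1))).mul
      (hexp t)).div_const (z ^ 2)
    refine this.congr_deriv ?_
    rw [tent_eq_of_le_one hlam ht.2]
    push_cast
    field_simp
    ring
  have h2 : ∫ t in (1 : ℝ)..lam, (tent lam t : ℂ) * Complex.exp (-(z * t)) =
      ((((lam : ℝ) - lam : ℂ) * z + 1) * Complex.exp (-(z * lam)) / z ^ 2) -
        ((((1 : ℝ) - lam : ℂ) * z + 1) * Complex.exp (-(z * (1 : ℝ))) / z ^ 2) := by
    refine intervalIntegral.integral_eq_sub_of_hasDerivAt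
      (f := fun t : ℝ => (((t : ℂ) - lam) * z + 1) * Complex.exp (-(z * t)) / z ^ 2)
      (fun t ht => ?_) (hcont 1 lam)
    rw [uIcc_of_le hlam.le] at ht
    have := (((((hid t).sub_const (lam : ℂ)).mul_const z).add_const 1).mul
      (hexp t)).div_const (z ^ 2)
    refine this.congr_deriv ?_
    rw [tent_eq_of_one_le hlam ht.1]
    push_cast
    field_simp
    ring
  rw [h1, h2]
  simp only [Complex.ofReal_one, Complex.ofReal_zero, mul_zero, neg_zero, Complex.exp_zero, mul_one]
  field_simp
  ring

/-- The measure on `(0, λ]` with density the tent function. -/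
noncomputable def tentMeasure (lam : ℝ) : Measure ℝ :=
  (volume.restrict (Ioc 0 lam)).withDensity fun t => ENNReal.ofReal (tent lam t)

instance isFiniteMeasure_tentMeasure (lam : ℝ) : IsFiniteMeasure (tentMeasure lam) :=
  isFiniteMeasure_withDensity_ofReal
    ((continuous_tent lam).integrableOn_Ioc (μ := volume) (a := 0) (b := lam)).2

lemma ae_tentMeasure (lam : ℝ) : ∀ᵐ t ∂tentMeasure lam, 0 < t :=
  (withDensity_absolutelyContinuous _ _).ae_le
    ((ae_restrict_mem measurableSet_Ioc).mono fun _ ht => ht.1)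

lemma integral_tentMeasure {lam : ℝ} (hlam : 1 < lam) {E : Type*} [NormedAddCommGroup E]
    [NormedSpace ℝ E] (g : ℝ → E) :
    ∫ t, g t ∂tentMeasure lam = ∫ t in (0 : ℝ)..lam, tent lam t • g t := by
  rw [tentMeasure, integral_withDensity_eq_integral_toReal_smul (by fun_prop)
    (ae_of_all _ fun _ => ENNReal.ofReal_lt_top),
    intervalIntegral.integral_of_le (by linarith)]
  refine setIntegral_congr_fun measurableSet_Ioc fun t ht => ?_
  simp only [ENNReal.toReal_ofReal (tent_nonneg hlam ht)]

lemma lintegral_tentMeasure {lam x : ℝ} (hlam : 1 < lam) (hx : 0 < x) :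
    ∫⁻ t, ENNReal.ofReal (1 / (t + x) ^ (2 : ℝ)) ∂tentMeasure lam =
      ENNReal.ofReal (-Real.log (gRatio lam x) - -Real.log (gRatio lam (x + 1))) := by
  have hpos : ∀ᵐ t ∂tentMeasure lam, 0 ≤ 1 / (t + x) ^ (2 : ℝ) :=
    (ae_tentMeasure lam).mono fun t ht => by positivity
  rw [neg_log_gRatio_sub (by linarith) hx, ← integral_tent_div_sq hlam hx]
  simp_rw [← smul_eq_mul]
  rw [← integral_tentMeasure hlam]
  refine (ofReal_integral_eq_lintegral_ofReal ?_ hpos).symm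
  refine (integrable_const (1 / x ^ (2 : ℝ))).mono' (Measurable.aestronglyMeasurable (by fun_prop)) ?_
  filter_upwards [hpos, ae_tentMeasure lam] with t ht ht0
  rw [Real.norm_of_nonneg ht]
  gcongr
  linarith

lemma complexMGF_neg_tentMeasure {lam : ℝ} (hlam : 1 < lam) {z : ℂ} (hz : z ≠ 0) :
    complexMGF (fun t => -t) (tentMeasure lam) z =
      (lam * (1 - Complex.exp (-z)) - (1 - Complex.exp (-(z * lam)))) / z ^ 2 := by
  rw [complexMGF, integral_tentMeasure hlam, ← integral_tent_mul_cexp hlam hz]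
  simp

lemma norm_complexMGF_neg_tentMeasure_le {lam : ℝ} {z : ℂ} (hz : 0 ≤ z.re) :
    ‖complexMGF (fun t => -t) (tentMeasure lam) z‖ ≤ (tentMeasure lam).real univ := by
  have := norm_integral_le_of_norm_le_const (μ := tentMeasure lam) (C := 1)
    (f := fun t : ℝ => Complex.exp (z * ((-t : ℝ) : ℂ)))
    ((ae_tentMeasure lam).mono fun t ht => by
      rw [Complex.norm_exp, Real.exp_le_one_iff]
      simp
      positivity)
  simpa [complexMGF] using this

/-! ### The representing measure of order 2 -/

/-- The sum of all translates of `tentMeasure` by natural numbers. -/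
noncomputable def tentSeriesMeasure (lam : ℝ) : Measure ℝ :=
  Measure.sum fun j : ℕ => (tentMeasure lam).map (· + (j : ℝ))

lemma ae_tentSeriesMeasure (lam : ℝ) : ∀ᵐ t ∂tentSeriesMeasure lam, 0 ≤ t := by
  refine Measure.ae_sum_iff.2 fun j => ?_
  rw [ae_map_iff (by fun_prop) measurableSet_Ici]
  exact (ae_tentMeasure lam).mono fun t ht => by positivity

lemma lintegral_tentSeriesMeasure {lam x : ℝ} (hlam : 1 < lam) (hx : 0 < x) :
    ∫⁻ t, ENNReal.ofReal (1 / (t + x) ^ (2 : ℝ)) ∂tentSeriesMeasure lam =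
      ENNReal.ofReal (-Real.log (gRatio lam x)) := by
  set f : ℝ → ℝ := fun y => -Real.log (gRatio lam y) with hf
  have htend : Tendsto (fun n : ℕ => f (x + n)) atTop (𝓝 0) :=
    tendsto_neg_log_gRatio_add_nat (by linarith) hx
  have hterm : ∀ j : ℕ, ∫⁻ t, ENNReal.ofReal (1 / (t + x) ^ (2 : ℝ))
      ∂((tentMeasure lam).map (· + (j : ℝ))) =
        ENNReal.ofReal (f (x + j) - f (x + (j + 1 : ℕ))) := fun j => by
    rw [lintegral_map (by fun_prop) (by fun_prop)]
    simp only [add_assoc]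
    rw [add_comm (j : ℝ) x, lintegral_tentMeasure hlam (by positivity)]
    push_cast
    rw [add_assoc]
  have hsum : HasSum (fun j : ℕ => f (x + j) - f (x + (j + 1 : ℕ))) (f x) := by
    rw [hasSum_iff_tendsto_nat_of_nonneg fun j => ?_]
    · simp_rw [Finset.sum_range_sub' (fun j : ℕ => f (x + j))]
      simpa using (tendsto_const_nhds (x := f x)).sub htend
    · have := neg_log_gRatio_add_one_lt hlam (x := x + j) (by positivity)
      simp only [hf]
      push_cast
      rw [← add_assoc]
      linarith
  rw [tentSeriesMeasure, lintegral_sum_measure]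
  simp_rw [hterm]
  rw [← ENNReal.ofReal_tsum_of_nonneg (fun j => ?_) hsum.summable, hsum.tsum_eq]
  have := neg_log_gRatio_add_one_lt hlam (x := x + j) (by positivity)
  simp only [hf]
  push_cast
  rw [← add_assoc]
  linarith

lemma neg_log_gRatio_nonneg {lam x : ℝ} (hlam : 1 < lam) (hx : 0 < x) :
    0 ≤ -Real.log (gRatio lam x) := by
  refine (antitone_nat_of_succ_le
    (f := fun n : ℕ => -Real.log (gRatio lam (x + n))) fun n => ?_).le_of_tendsto
    (tendsto_neg_log_gRatio_add_nat (by linarith) hx) 0 |>.trans_eq (by simp)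
  have := neg_log_gRatio_add_one_lt hlam (x := x + n) (by positivity)
  push_cast
  rw [← add_assoc]
  exact this.le

lemma integrable_tentSeriesMeasure {lam x : ℝ} (hlam : 1 < lam) (hx : 0 < x) :
    Integrable (fun t : ℝ => 1 / (t + x) ^ (2 : ℝ)) (tentSeriesMeasure lam) := by
  rw [← lintegral_ofReal_ne_top_iff_integrable (Measurable.aestronglyMeasurable (by fun_prop))
    ((ae_tentSeriesMeasure lam).mono fun t ht => by positivity),
    lintegral_tentSeriesMeasure hlam hx]
  exact ENNReal.ofReal_ne_top

lemma integral_tentSeriesMeasure {lam x : ℝ} (hlam : 1 < lam) (hx : 0 < x) :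
    ∫ t, 1 / (t + x) ^ (2 : ℝ) ∂tentSeriesMeasure lam = -Real.log (gRatio lam x) := by
  rw [integral_eq_lintegral_of_nonneg_ae
    ((ae_tentSeriesMeasure lam).mono fun t ht => by positivity)
    (Measurable.aestronglyMeasurable (by fun_prop)),
    lintegral_tentSeriesMeasure hlam hx, ENNReal.toReal_ofReal (neg_log_gRatio_nonneg hlam hx)]

/-- Translation by `j` multiplies the transform by `exp (-z) ^ j`; the geometric series converges
since `Re z > 0`. -/
lemma complexMGF_neg_tentSeriesMeasure {lam : ℝ} (hlam : 1 < lam) {z : ℂ} (hz : 0 < z.re) :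
    complexMGF (fun t => -t) (tentSeriesMeasure lam) z =
      (1 - Complex.exp (-z))⁻¹ * complexMGF (fun t => -t) (tentMeasure lam) z := by
  have hint : Integrable (fun t : ℝ => Complex.exp (z * ((-t : ℝ) : ℂ)))
      (tentSeriesMeasure lam) := by
    rw [← integrable_norm_iff (by fun_prop)]
    simpa [Complex.norm_exp] using integrable_exp_neg_mul_of_integrable_one_div_add_rpow two_pos
      (ae_tentSeriesMeasure lam) (integrable_tentSeriesMeasure hlam one_pos) hz
  have hnorm : ‖Complex.exp (-z)‖ < 1 := by
    rw [Complex.norm_exp, Real.exp_lt_one_iff, Complex.neg_re]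
    linarith
  have hgeom : HasSum (fun j : ℕ => Complex.exp (-z) ^ j *
      complexMGF (fun t => -t) (tentMeasure lam) z)
      ((1 - Complex.exp (-z))⁻¹ * complexMGF (fun t => -t) (tentMeasure lam) z) :=
    (hasSum_geometric_of_norm_lt_one hnorm).mul_right _
  rw [tentSeriesMeasure] at hint
  have hterm : ∀ j : ℕ, ∫ t, Complex.exp (z * ((-t : ℝ) : ℂ))
      ∂((tentMeasure lam).map (· + (j : ℝ))) =
        Complex.exp (-z) ^ j * complexMGF (fun t => -t) (tentMeasure lam) z := by
    intro j
    rw [integral_map (by fun_prop) (by fun_prop), complexMGF, ← Complex.exp_nat_mul,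
      ← integral_const_mul]
    refine integral_congr_ae (ae_of_all _ fun t => ?_)
    simp only
    rw [← Complex.exp_add]
    congr 1
    push_cast
    ring
  have hsum := hasSum_integral_measure hint
  simp only [hterm] at hsum
  rw [complexMGF, tentSeriesMeasure]
  exact hsum.unique hgeom

/-! ### Membership for order 2 and failure below it -/

lemma neg_log_gRatio_mem_genStieltjes_two {lam : ℝ} (hlam : 1 < lam) :
    (fun x : ℝ => -Real.log (gRatio lam x)) ∈ genStieltjes 2 := by
  refine ⟨tentSeriesMeasure lam, 0, le_rfl, fun x hx => ?_⟩
  have hres : (tentSeriesMeasure lam).restrict (Ici 0) = tentSeriesMeasure lam :=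
    Measure.restrict_eq_self_of_ae_mem (ae_tentSeriesMeasure lam)
  rw [IntegrableOn, hres, integral_tentSeriesMeasure hlam hx]
  exact ⟨integrable_tentSeriesMeasure hlam hx, (add_zero _).symm⟩

/-- For `τ ≤ 0` the kernel is nondecreasing in `x`, whereas `-log g_λ` is strictly smaller at `2`
than at `1`. -/
lemma neg_log_gRatio_notMem_genStieltjes_of_nonpos {lam τ : ℝ} (hlam : 1 < lam) (hτ : τ ≤ 0) :
    (fun x : ℝ => -Real.log (gRatio lam x)) ∉ genStieltjes τ := by
  rintro ⟨μ, c, -, h⟩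
  obtain ⟨h1, e1⟩ := h 1 one_pos
  obtain ⟨h2, e2⟩ := h (1 + 1) (by norm_num)
  have hle : ∫ t in Ici (0 : ℝ), 1 / (t + 1) ^ τ ∂μ ≤
      ∫ t in Ici (0 : ℝ), 1 / (t + (1 + 1)) ^ τ ∂μ := by
    refine setIntegral_mono_on h1 h2 measurableSet_Ici fun t (ht : 0 ≤ t) => ?_
    refine one_div_le_one_div_of_le (by positivity) ?_
    exact Real.rpow_le_rpow_of_nonpos (by positivity) (by linarith) hτ
  have := neg_log_gRatio_add_one_lt hlam one_pos
  simp only at e1 e2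
  rw [e1, e2] at this
  exact (lt_of_add_lt_add_right this).not_ge hle

/-- If `-log g_λ` is a generalized Stieltjes function of some order `τ ∈ (0, 2)`, then
`exp (-2πiλ) = 1`, because the Laplace transform of the tent function vanishes at `2πi`. -/
lemma cexp_eq_one_of_neg_log_gRatio_mem_genStieltjes {lam τ : ℝ} (hlam : 1 < lam) (hτ0 : 0 < τ)
    (hτ : τ < 2) (h : (fun x : ℝ => -Real.log (gRatio lam x)) ∈ genStieltjes τ) :
    Complex.exp (-(2 * Real.pi * Complex.I * lam)) = 1 := by
  obtain ⟨μ, c, hc, h⟩ := h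
  -- The integral is nonnegative, so `c ≤ f(1 + n) → 0`.
  have hc0 : c = 0 := by
    refine le_antisymm (ge_of_tendsto' (tendsto_neg_log_gRatio_add_nat (by linarith : 0 < lam)
      one_pos) fun n => ?_) hc
    have h1 : 0 ≤ ∫ t in Ici (0 : ℝ), 1 / (t + (1 + (n : ℝ))) ^ τ ∂μ :=
      setIntegral_nonneg measurableSet_Ici fun t (ht : 0 ≤ t) => by positivity
    have h2 := (h (1 + n) (by positivity)).2
    simp only at h2
    linarith
  set z : ℝ → ℂ := fun a => a + 2 * Real.pi * Complex.I with hz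
  set W : ℂ → ℂ := complexMGF (fun t => -t) (tentMeasure lam) with hW
  set K : ℝ := (tentMeasure lam).real univ
  have hre : ∀ a, (z a).re = a := fun a => by simp [hz]
  have hexp : ∀ a, Complex.exp (-z a) = Complex.exp (-(a : ℂ)) := fun a => by
    rw [hz, neg_add, Complex.exp_add, Complex.exp_neg (2 * Real.pi * Complex.I),
      Complex.exp_two_pi_mul_I, inv_one, mul_one]
  have hineq : ∀ a : ℝ, 0 < a → ‖W (z a)‖ ≤ (a / ‖z a‖) ^ (2 - τ) * K := by
    intro a ha
    have hle := norm_laplace_le_of_stieltjes_eq (μ := μ.restrict (Ici 0)) hτ0 two_pos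
      (ae_restrict_mem measurableSet_Ici) (ae_tentSeriesMeasure lam) (fun x hx => (h x hx).1)
      (fun x hx => integrable_tentSeriesMeasure hlam hx)
      (fun x hx => by
        rw [integral_tentSeriesMeasure hlam hx]
        simpa [hc0] using (h x hx).2.symm) (z := z a) ((hre a).symm ▸ ha)
    have hare : 0 < (a : ℂ).re := by simpa using ha
    rw [hre, complexMGF_neg_tentSeriesMeasure hlam ((hre a).symm ▸ ha),
      complexMGF_neg_tentSeriesMeasure hlam hare, hexp, norm_mul, norm_mul, mul_left_comm] at hle
    -- By `2πi`-periodicity both sides carry the same factor `(1 - exp (-a))⁻¹`, which cancels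
    -- although it blows up as `a → 0`.
    have hne : (1 - Complex.exp (-(a : ℂ))) ≠ 0 := by
      rw [sub_ne_zero, ← Complex.ofReal_neg, ← Complex.ofReal_exp]
      norm_cast
      exact (Real.exp_lt_one_iff.2 (by linarith)).ne'
    refine (le_of_mul_le_mul_left hle
      (norm_pos_iff.2 (inv_ne_zero hne))).trans ?_
    gcongr
    exact norm_complexMGF_neg_tentMeasure_le (by simpa using ha.le)
  have hcz : Continuous z := by fun_prop
  have hz0 : z 0 = 2 * Real.pi * Complex.I := by simp [hz]
  have hz0' : z 0 ≠ 0 := by rw [hz0]; exact Complex.two_pi_I_ne_zero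
  have hWeq : ∀ w : ℂ, w ≠ 0 → W w =
      (lam * (1 - Complex.exp (-w)) - (1 - Complex.exp (-(w * lam)))) / w ^ 2 := fun w hw =>
    complexMGF_neg_tentMeasure hlam hw
  -- The point `2πi` lies on the boundary of the half plane, so continuity is read off the closed
  -- form, valid for all `w ≠ 0`.
  have hWc : ContinuousAt W (z 0) := by
    refine ContinuousAt.congr (f := fun w : ℂ =>
      (lam * (1 - Complex.exp (-w)) - (1 - Complex.exp (-(w * lam)))) / w ^ 2) ?_
      ((isOpen_ne.eventually_mem hz0').mono fun w hw => (hWeq w hw).symm)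
    exact ContinuousAt.div (by fun_prop) (by fun_prop) (pow_ne_zero 2 hz0')
  have hl : Tendsto (fun a => ‖W (z a)‖) (𝓝[>] 0) (𝓝 ‖W (z 0)‖) :=
    ((hWc.comp hcz.continuousAt).norm.tendsto).mono_left nhdsWithin_le_nhds
  -- Here `τ < 2` is decisive: the exponent `2 - τ` is positive and `‖z a‖` stays away from `0`.
  have hr : Tendsto (fun a => (a / ‖z a‖) ^ (2 - τ) * K) (𝓝[>] 0) (𝓝 0) := by
    have hq : ContinuousAt (fun a : ℝ => (a / ‖z a‖) ^ (2 - τ) * K) 0 :=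
      ((continuousAt_id.div hcz.norm.continuousAt (norm_ne_zero_iff.2 hz0')).rpow_const
        (Or.inr (by linarith))).mul continuousAt_const
    have := hq.tendsto.mono_left (nhdsWithin_le_nhds (s := Ioi 0))
    simpa [Real.zero_rpow (by linarith : 2 - τ ≠ 0)] using this
  have hW0 : W (z 0) = 0 := norm_le_zero_iff.1
    (le_of_tendsto_of_tendsto hl hr (eventually_nhdsWithin_of_forall hineq))
  rw [hWeq _ hz0', div_eq_zero_iff, or_iff_left (pow_ne_zero 2 hz0'), hexp] at hW0
  simp only [Complex.ofReal_zero, neg_zero, Complex.exp_zero, sub_self, mul_zero, zero_sub,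
    neg_sub, hz0] at hW0
  exact sub_eq_zero.1 hW0

theorem proposition3p3 (lam : ℝ) (hlam : 1 < lam) :
    (fun x : ℝ => -Real.log (gRatio lam x)) ∈ genStieltjes 2 ∧
    ((∀ n : ℤ, lam ≠ (n : ℝ)) →
      ∀ τ : ℝ, τ < 2 → (fun x : ℝ => -Real.log (gRatio lam x)) ∉ genStieltjes τ) := by
  refine ⟨neg_log_gRatio_mem_genStieltjes_two hlam, fun hint τ hτ h => ?_⟩
  rcases le_or_gt τ 0 with hτ0 | hτ0
  · exact neg_log_gRatio_notMem_genStieltjes_of_nonpos hlam hτ0 h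
  · obtain ⟨n, hn⟩ := Complex.exp_eq_one_iff.1
      (cexp_eq_one_of_neg_log_gRatio_mem_genStieltjes hlam hτ0 hτ h)
    refine hint (-n) ?_
    have h1 : (lam : ℂ) = -n := by
      refine mul_left_cancel₀ Complex.two_pi_I_ne_zero ?_
      linear_combination -hn
    exact_mod_cast h1
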